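/- \textbf{Types and functionals.} The finite types are $0$, of rank $\mathbf r(0)=0$, and $\sigma=(\sigma_1,\dots,\sigma_n\to 0)$, of rank $\mathbf r(\sigma)=\max_i(\mathbf r(\sigma_i)+1)$, where $(\sigma_1,\dots,\sigma_n\to0)$ is identified with $\sigma_1\to(\sigma_2,\dots,\sigma_n\to 0)$; write $1=(0\to0)$ and $2=(1\to 0)$. Let $\mathbf F(0)=\mathbb N$ and $\mathbf P(0)=\mathbb N_\bot=\mathbb N\cup\{\bot\}$; for $\sigma=(\sigma_1,\dots,\sigma_n\to0)$, let $\mathbf F(\sigma)$ (total functionals) and $\mathbf P(\sigma)$ (partial functionals) be the sets of all maps from $\mathbf F(\sigma_1)\times\dots\times\mathbf F(\sigma_n)$ to $\mathbb N$ and to $\mathbb N_\bot$, respectively. Thus $\mathbf F(\sigma)\subseteq\mathbf P(\sigma)$, and $\mathbf P(\sigma)$ is ordered by extension $\preceq$. \textbf{Computability.} Terms are built from typed variables of types of rank $\le 3$ and the constants $0$, $\mathsf{suc}$, $\mathsf{pred}$ (with $\mathsf{pred}(0)=0$) and $\mathsf{case}$ of type $0,0,0\to0$, by application, by abstraction $\lambda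 x^\sigma t$ with $t$ of type $\tau$ and $\mathbf r(\sigma\to\tau)\le 3$, and by $\mu x^\sigma t$ with $t$ of type $\sigma$ and $\mathbf r(\sigma)\le 3$. Relative to an assignment of partial functionals to the free variables, a term $t$ of type $\sigma$ has an interpretation $[[t]]\in\mathbf P(\sigma)$, monotone in the assignment: $[[uv]]=[[u]]([[v]])$ if $[[v]]$ is total, and $[[uv]]$ is everywhere undefined otherwise; $[[\lambda x t]]$ maps each total $\phi$ to the value of $t$ at $x=\phi$; $[[\mu xt]]$ is the least fixed point of the operator $x\mapsto[[t]]$; $\mathsf{case}(z,x,y)$ is undefined if $z=\bot$, is $x$ if $z=0$, and is $y$ if $z>0$, where the argument that is not selected may be undefined. A partial functional $\psi$ is \emph{computable in} $\Phi$ if there is a term $s$ with at most one free variable $x$, of the type of $\Phi$, such that $\psi\preceq[[s]]$ when $x$ is assigned $\Phi$. \textbf{Countably based functionals.} Let $\sigma=(\tau_1,\dots,\tau_n\to0)$ have rank $\le3$, where $\tau_i=(\delta_{i,1},\dots,\delta_{i,m_i}\to0)$. A total $\Phi\in\mathbf F(\sigma)$ is \emph{countably based} if for all $(F_1,\dots,F_n)\in\mathbf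 F(\tau_1)\times\dots\times\mathbf F(\tau_n)$ there are countable sets $X_i\subseteq\mathbf F(\delta_{i,1})\times\dots\times\mathbf F(\delta_{i,m_i})$ such that $\Phi(F_1,\dots,F_n)=\Phi(G_1,\dots,G_n)$ whenever $F_i$ and $G_i$ are equal on $X_i$ for each $i=1,\dots,n$. \textbf{The functional $\Omega_1$.} Let $\Omega_1\in\mathbf P(2\to1)$ be the partial functional that is defined exactly at the characteristic functions $F\in\mathbf F(2)$ of the singletons $\{x\}\subseteq\mathbb N^{\mathbb N}$, where $\Omega_1(F)=x$. \textbf{Theorem.} Let $\Phi$ be a total countably based functional of a type of rank $3$. Then $\Omega_1$ is not computable in $\Phi$. -/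

import Mathlib

namespace HigherComp

/-- Types of finite rank, in curried form: every type is `0` or of the form
`σ₁ → (σ₂ → ⋯ → (σₙ → 0))`, the latter being the type written `(σ₁, …, σₙ → 0)`. -/
inductive Ty : Type
  | nat : Ty
  | arr : Ty → Ty → Ty

namespace Ty

/-- The rank: `r(0) = 0` and `r(σ₁, …, σₙ → 0) = max (r(σᵢ) + 1)`. -/
def rank : Ty → ℕ
  | nat => 0
  | arr σ τ => max (rank σ + 1) (rank τ)

/-- The pure types of rank `1` and `2`. -/
abbrev one : Ty := arr nat nat
abbrev two : Ty := arr one nat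

end Ty

/-- The total functionals of a type. -/
def Tot : Ty → Type
  | .nat => ℕ
  | .arr σ τ => Tot σ → Tot τ

/-- The partial functionals of a type: they take total arguments only, and their values lie
in `ℕ ∪ {⊥}`, which is `Part ℕ`. -/
def Par : Ty → Type
  | .nat => Part ℕ
  | .arr σ τ => Tot σ → Par τ

/-- The extension order `⪯`: pointwise, from the flat order on `Part ℕ`. -/
instance Par.instPartialOrder : (σ : Ty) → PartialOrder (Par σ)
  | .nat => inferInstanceAs (PartialOrder (Part ℕ))
  | .arr σ τ =>
    letI := Par.instPartialOrder τ
    inferInstanceAs (PartialOrder (Tot σ → Par τ))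

/-- The everywhere undefined functional. -/
def Par.undef : (σ : Ty) → Par σ
  | .nat => (Part.none : Part ℕ)
  | .arr _ τ => fun _ => Par.undef τ

/-- A total functional seen as a partial one. -/
def Tot.toPar : (σ : Ty) → Tot σ → Par σ
  | .nat, n => Part.some (n : ℕ)
  | .arr _ τ, f => fun x => Tot.toPar τ (f x)

open Classical in
/-- Application of a partial functional to a partial object: everywhere undefined unless the
argument is total. -/
noncomputable def Par.app {σ τ : Ty} (u : Par (.arr σ τ)) (v : Par σ) : Par τ :=
  if h : ∃ x : Tot σ, Tot.toPar σ x = v then u h.choose else Par.undef τ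

open Classical in
/-- The least fixed point of an operator (which exists for the monotone ones, see
`Par.isLeast_lfp`). -/
noncomputable def Par.lfp {σ : Ty} (f : Par σ → Par σ) : Par σ :=
  if h : ∃ ψ, IsLeast {ψ | f ψ = ψ} ψ then h.choose else Par.undef σ

theorem Par.undef_le : ∀ {σ : Ty} (φ : Par σ), Par.undef σ ≤ φ
  | .nat, φ => (bot_le : (⊥ : Part ℕ) ≤ φ)
  | .arr _ _, φ => fun x => Par.undef_le (φ x)

theorem Par.exists_isLUB : ∀ {σ : Ty} (c : Set (Par σ)), IsChain (· ≤ ·) c →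
    ∃ φ, IsLUB c φ
  | .nat, c, hc => by
    change Set (Part ℕ) at c
    by_cases h : ∃ n : ℕ, Part.some n ∈ c
    · obtain ⟨n, hn⟩ := h
      refine ⟨(Part.some n : Part ℕ), fun p hp => ?_, fun q hq => hq hn⟩
      rcases hc.total hp hn with h | h
      · exact h
      · intro m hm
        have h1 := h n (Part.mem_some n)
        have h2 : m = n := Part.mem_unique hm h1
        subst h2
        exact Part.mem_some m
    · refine ⟨(Part.none : Part ℕ), fun p hp m hm => ?_, fun q _ => (bot_le : (⊥ : Part ℕ) ≤ q)⟩
      exact absurd ⟨m, (Part.eq_some_iff.2 hm : p = Part.some m) ▸ hp⟩ h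
  | .arr σ τ, c, hc => by
    have key : ∀ x : Tot σ, ∃ φ : Par τ, IsLUB ((fun f : Par (.arr σ τ) => f x) '' c) φ := by
      intro x
      refine Par.exists_isLUB _ ?_
      rintro _ ⟨f, hf, rfl⟩ _ ⟨g, hg, rfl⟩ _
      exact (hc.total hf hg).imp (fun h => h x) (fun h => h x)
    choose φ hφ using key
    refine ⟨φ, fun f hf x => (hφ x).1 ⟨f, hf, rfl⟩, fun g hg x => (hφ x).2 ?_⟩
    rintro _ ⟨f, hf, rfl⟩
    exact hg hf x

/-- A monotone operator has a least fixed point, which also is its least pre-fixed point. -/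
theorem Par.exists_lfp {σ : Ty} (f : Par σ → Par σ) (hf : Monotone f) :
    ∃ ψ, f ψ = ψ ∧ ∀ χ, f χ ≤ χ → ψ ≤ χ := by
  let A : Set (Par σ) := {ψ | ψ ≤ f ψ ∧ ∀ χ, f χ ≤ χ → ψ ≤ χ}
  obtain ⟨m, hm⟩ := zorn_le₀ A (by
    intro c hcA hc
    obtain ⟨u, hu⟩ := Par.exists_isLUB c hc
    refine ⟨u, ⟨hu.2 fun ψ hψ => ?_, fun χ hχ => hu.2 fun ψ hψ => (hcA hψ).2 χ hχ⟩, hu.1⟩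
    exact (hcA hψ).1.trans (hf (hu.1 hψ)))
  have hfm : f m ∈ A := ⟨hf hm.1.1, fun χ hχ => (hf (hm.1.2 χ hχ)).trans hχ⟩
  exact ⟨m, le_antisymm (hm.2 hfm hm.1.1) hm.1.1, hm.1.2⟩

theorem Par.isLeast_lfp {σ : Ty} (f : Par σ → Par σ) (hf : Monotone f) :
    IsLeast {ψ | f ψ = ψ} (Par.lfp f) := by
  have h : ∃ ψ, IsLeast {ψ | f ψ = ψ} ψ := by
    obtain ⟨ψ, h1, h2⟩ := Par.exists_lfp f hf
    exact ⟨ψ, h1, fun χ hχ => h2 χ (le_of_eq hχ)⟩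
  unfold Par.lfp
  rw [dif_pos h]
  exact h.choose_spec

theorem Par.lfp_le {σ : Ty} (f : Par σ → Par σ) (hf : Monotone f) {χ : Par σ} (h : f χ ≤ χ) :
    Par.lfp f ≤ χ := by
  obtain ⟨ψ, h1, h2⟩ := Par.exists_lfp f hf
  exact ((Par.isLeast_lfp f hf).2 h1).trans (h2 χ h)

/-- Typed variables of a context (de Bruijn indices). -/
inductive Var : List Ty → Ty → Type
  | here {Γ : List Ty} {σ : Ty} : Var (σ :: Γ) σ
  | there {Γ : List Ty} {σ τ : Ty} : Var Γ σ → Var (τ :: Γ) σ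

/-- Terms without secondary constants, with free variables among those of the context `Γ`.

The constant `case` of type `0, 0, 0 → 0` comes as a term former with three arguments, since it
is strict only in its first argument; the constant itself is its `λ`-abstraction. -/
inductive Term : List Ty → Ty → Type
  | var {Γ : List Ty} {σ : Ty} : σ.rank ≤ 3 → Var Γ σ → Term Γ σ
  | zero {Γ : List Ty} : Term Γ .nat
  | suc {Γ : List Ty} : Term Γ .one
  | pred {Γ : List Ty} : Term Γ .one
  | case {Γ : List Ty} : Term Γ .nat → Term Γ .nat → Term Γ .nat → Term Γ .nat
  | app {Γ : List Ty} {σ τ : Ty} : Term Γ (.arr σ τ) → Term Γ σ → Term Γ τ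
  | lam {Γ : List Ty} {σ τ : Ty} : (Ty.arr σ τ).rank ≤ 3 → Term (σ :: Γ) τ → Term Γ (.arr σ τ)
  | mu {Γ : List Ty} {σ : Ty} : σ.rank ≤ 3 → Term (σ :: Γ) σ → Term Γ σ

/-- Assignments of partial objects to the variables of a context. -/
def Env : List Ty → Type
  | [] => Unit
  | σ :: Γ => Par σ × Env Γ

/-- The object assigned to a variable. -/
def Env.get : {Γ : List Ty} → {σ : Ty} → Env Γ → Var Γ σ → Par σ
  | _, _, ρ, .here => ρ.1
  | _, _, ρ, .there x => Env.get ρ.2 x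

/-- The value of `case` on `z`, `x`, `y`: it is `x` if `z = 0`, it is `y` if `z` is a positive
integer, and it is undefined if `z` is. -/
def caseVal (z x y : Part ℕ) : Part ℕ :=
  z.bind fun n => if n = 0 then x else y

/-- The interpretation of terms. -/
noncomputable def Term.interp : {Γ : List Ty} → {σ : Ty} → Term Γ σ → Env Γ → Par σ
  | _, _, .var _ x, ρ => ρ.get x
  | _, _, .zero, _ => Part.some 0
  | _, _, .suc, _ => fun n : ℕ => Part.some (n + 1)
  | _, _, .pred, _ => fun n : ℕ => Part.some (n - 1)
  | _, _, .case z x y, ρ => caseVal (z.interp ρ) (x.interp ρ) (y.interp ρ)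
  | _, _, .app u v, ρ => Par.app (u.interp ρ) (v.interp ρ)
  | _, _, .lam (σ := σ) _ t, ρ => fun x => t.interp (Tot.toPar σ x, ρ)
  | _, _, .mu _ t, ρ => Par.lfp fun ψ => t.interp (ψ, ρ)

theorem Tot.toPar_injective : ∀ σ : Ty, Function.Injective (Tot.toPar σ)
  | .nat => fun _ _ h => Part.some_injective (α := ℕ) h
  | .arr _ τ => fun _ _ h => funext fun x => Tot.toPar_injective τ (congrFun h x)

theorem Par.app_toPar {σ τ : Ty} (u : Par (.arr σ τ)) (x : Tot σ) :
    Par.app u (Tot.toPar σ x) = u x := by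
  have h : ∃ y : Tot σ, Tot.toPar σ y = Tot.toPar σ x := ⟨x, rfl⟩
  unfold Par.app
  rw [dif_pos h, Tot.toPar_injective σ h.choose_spec]

/-- Total functionals are maximal. -/
theorem Tot.eq_of_toPar_le : ∀ {σ : Ty} {x : Tot σ} {φ : Par σ}, Tot.toPar σ x ≤ φ →
    φ = Tot.toPar σ x
  | .nat, x, _, h => Part.eq_some_iff.2 (h (x : ℕ) (Part.mem_some (x : ℕ)))
  | .arr _ _, _, _, h => funext fun y => Tot.eq_of_toPar_le (h y)

theorem Par.app_mono {σ τ : Ty} {u u' : Par (.arr σ τ)} {v v' : Par σ} (hu : u ≤ u')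
    (hv : v ≤ v') : Par.app u v ≤ Par.app u' v' := by
  by_cases h : ∃ x : Tot σ, Tot.toPar σ x = v
  · obtain ⟨x, rfl⟩ := h
    rw [Tot.eq_of_toPar_le hv, Par.app_toPar, Par.app_toPar]
    exact hu x
  · have : Par.app u v = Par.undef τ := dif_neg h
    rw [this]
    exact Par.undef_le _

/-- The pointwise extension order on assignments. -/
def Env.Le : {Γ : List Ty} → Env Γ → Env Γ → Prop
  | [], _, _ => True
  | _ :: _, ρ, ρ' => ρ.1 ≤ ρ'.1 ∧ Env.Le ρ.2 ρ'.2

theorem Env.Le.refl : ∀ {Γ : List Ty} (ρ : Env Γ), Env.Le ρ ρ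
  | [], _ => trivial
  | _ :: _, ρ => ⟨le_refl ρ.1, Env.Le.refl ρ.2⟩

theorem Env.Le.get : ∀ {Γ : List Ty} {σ : Ty} {ρ ρ' : Env Γ} (x : Var Γ σ), Env.Le ρ ρ' →
    ρ.get x ≤ ρ'.get x
  | _, _, _, _, .here, h => h.1
  | _, _, _, _, .there x, h => Env.Le.get x h.2

theorem caseVal_mono {z z' x x' y y' : Part ℕ} (hz : z ≤ z') (hx : x ≤ x') (hy : y ≤ y') :
    caseVal z x y ≤ caseVal z' x' y' := by
  intro m hm
  simp only [caseVal, Part.mem_bind_iff] at hm ⊢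
  obtain ⟨n, hn, h⟩ := hm
  refine ⟨n, hz n hn, ?_⟩
  split_ifs at h ⊢
  · exact hx m h
  · exact hy m h

/-- The interpretation of a term is monotone. In particular, every `μ`-term is interpreted by an
actual least fixed point. -/
theorem Term.interp_mono {Γ : List Ty} {σ : Ty} (t : Term Γ σ) :
    ∀ {ρ ρ' : Env Γ}, Env.Le ρ ρ' → t.interp ρ ≤ t.interp ρ' := by
  induction t with
  | var _ x => exact fun h => h.get x
  | zero => exact fun _ => le_refl _
  | suc => exact fun _ => le_refl _
  | pred => exact fun _ => le_refl _
  | case z x y hz hx hy => exact fun h => caseVal_mono (hz h) (hx h) (hy h)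
  | app u v hu hv => exact fun h => Par.app_mono (hu h) (hv h)
  | lam _ t ht => exact fun h x => ht ⟨le_refl _, h⟩
  | mu _ t ht =>
    intro ρ ρ' h
    have hm : ∀ ρ, Monotone fun ψ => t.interp (ψ, ρ) :=
      fun ρ ψ χ hψ => ht ⟨hψ, Env.Le.refl ρ⟩
    change Par.lfp (fun ψ => t.interp (ψ, ρ)) ≤ Par.lfp (fun ψ => t.interp (ψ, ρ'))
    refine Par.lfp_le _ (hm ρ) ?_
    refine le_trans (ht (ρ' := (Par.lfp (fun ψ => t.interp (ψ, ρ')), ρ')) ⟨le_refl _, h⟩) ?_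
    exact le_of_eq (Par.isLeast_lfp _ (hm ρ')).1

/-- `ψ` is computable in `φ₁, …, φₙ` (the components of `φ`): some term with free variables
`x₁, …, xₙ` and without secondary constants has, at `φ₁, …, φₙ`, an interpretation that
extends `ψ`. -/
def ComputableIn {τ : Ty} (ψ : Par τ) {Γ : List Ty} (φ : Env Γ) : Prop :=
  ∃ s : Term Γ τ, ψ ≤ s.interp φ

/-- Argument tuples of the functionals of a type: `F(σ₁) × ⋯ × F(σₙ)` for `σ₁, …, σₙ → 0`. -/
def Args : Ty → Type
  | .nat => Unit
  | .arr σ τ => Tot σ × Args τ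

/-- The value of a total functional at an argument tuple. -/
def Tot.eval : {σ : Ty} → Tot σ → Args σ → ℕ
  | .nat, n, _ => n
  | .arr _ _, f, a => Tot.eval (f a.1) a.2

/-- Families `(X₁, …, Xₙ)`, for the type `τ₁, …, τₙ → 0`, of sets `Xᵢ` of argument tuples of the
functionals of type `τᵢ`. -/
def Support : Ty → Type
  | .nat => Unit
  | .arr σ τ => Set (Args σ) × Support τ

/-- All members of the family are countable. -/
def Support.Countable : {σ : Ty} → Support σ → Prop
  | .nat, _ => True
  | .arr _ _, X => X.1.Countable ∧ Support.Countable X.2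

/-- The argument tuples `(F₁, …, Fₙ)` and `(G₁, …, Gₙ)` are such that `Fᵢ` and `Gᵢ` are equal
on `Xᵢ` for each `i`. -/
def Support.Agree : {σ : Ty} → Support σ → Args σ → Args σ → Prop
  | .nat, _, _, _ => True
  | .arr _ _, X, a, b =>
    (∀ x ∈ X.1, Tot.eval a.1 x = Tot.eval b.1 x) ∧ Support.Agree X.2 a.2 b.2

/-- A total functional is countably based if each of its values has a countable support.
(The notion is meant for types of rank at most `3`.) -/
def CountablyBased {σ : Ty} (Φ : Tot σ) : Prop :=
  ∀ a : Args σ, ∃ X : Support σ, X.Countable ∧ ∀ b : Args σ, X.Agree a b → Φ.eval a = Φ.eval b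

/-- `F` is the characteristic function of the set `X` of elements of Baire space. -/
def IsChar (F : (ℕ → ℕ) → ℕ) (X : Set (ℕ → ℕ)) : Prop :=
  ∀ y, (y ∈ X → F y = 1) ∧ (y ∉ X → F y = 0)

/-- The partial functional `Ω₁`, of type `2 → 1`: it is defined exactly at the characteristic
functions of the sets `{x}`, where its value is `x`. -/
noncomputable def Omega1 : Par (.arr .two .one) :=
  fun (F : (ℕ → ℕ) → ℕ) (k : ℕ) => (⟨∃ x, IsChar F {x}, fun h => h.choose k⟩ : Part ℕ)

end HigherComp

/-! Fix a proper, countably complete filter `l` on an index set. `Uniform` is a logical relation on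
families of functionals: numerical families must be eventually constant once eventually defined, and
uniform arguments must give uniform values. Every term preserves it (`Term.uniform_interp`), the
hard case being `μ` (`Uniform.lfp`). A countably based Φ is uniform as a constant family
(`CountablyBased.uniform`), since a uniform family of arguments eventually agrees with a limit on
any given countable support. For the cocountable filter on Baire space, the family of characteristic
functions of `{x}` is uniform (`uniform_singletonChar`). If Ω₁ were computable in Φ, the family `x ↦
x` would thus be uniform, hence equal to a fixed point for all but countably many `x`, which is
absurd. -/

namespace HigherComp

open Filter

/-! ### Transfinite approximation of least fixed points -/

/-- The supremum of a set of partial functionals, which is meaningful if the set is a chain. -/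
noncomputable def Par.sup : {σ : Ty} → Set (Par σ) → Par σ
  | .nat, S =>
    open Classical in
    if h : ∃ n : ℕ, (Part.some n : Part ℕ) ∈ (S : Set (Part ℕ)) then Part.some h.choose
    else (Part.none : Part ℕ)
  | .arr _ _, S => fun x => Par.sup ((fun f => f x) '' S)

theorem Par.isLUB_sup : ∀ {σ : Ty} {S : Set (Par σ)}, IsChain (· ≤ ·) S → IsLUB S (Par.sup S)
  | .nat, S, hS => by
    change Set (Part ℕ) at S
    by_cases h : ∃ n : ℕ, Part.some n ∈ S
    · have e : Par.sup (σ := .nat) S = (Part.some h.choose : Part ℕ) := dif_pos h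
      rw [e]
      refine ⟨fun p hp => ?_, fun q hq => hq h.choose_spec⟩
      rcases hS.total hp h.choose_spec with h' | h'
      · exact h'
      · exact (Tot.eq_of_toPar_le (σ := .nat) (x := h.choose) h').le
    · have e : Par.sup (σ := .nat) S = (Part.none : Part ℕ) := dif_neg h
      rw [e]
      refine ⟨fun p hp m hm => ?_, fun q _ => (bot_le : (⊥ : Part ℕ) ≤ q)⟩
      exact absurd ⟨m, (Part.eq_some_iff.2 hm : p = Part.some m) ▸ hp⟩ h
  | .arr σ τ, S, hS => by
    have key (x : Tot σ) : IsLUB ((fun f : Par (.arr σ τ) => f x) '' S) (Par.sup S x) := by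
      refine Par.isLUB_sup ?_
      rintro _ ⟨f, hf, rfl⟩ _ ⟨g, hg, rfl⟩ _
      exact (hS.total hf hg).imp (fun h => h x) (fun h => h x)
    refine ⟨fun f hf x => (key x).1 ⟨f, hf, rfl⟩, fun g hg x => (key x).2 ?_⟩
    rintro _ ⟨f, hf, rfl⟩
    exact hg hf x

/-- The transfinite approximations from below to the least fixed point of an operator. -/
noncomputable def Par.approx {σ : Ty} (f : Par σ → Par σ) (α : Ordinal.{0}) : Par σ :=
  Par.sup {φ | ∃ β : Set.Iio α, φ = f (Par.approx f β)}
termination_by α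
decreasing_by exact β.2

/-- The set of stages whose supremum is the approximation at `α`. -/
def Par.stages {σ : Ty} (f : Par σ → Par σ) (α : Ordinal.{0}) : Set (Par σ) :=
  {φ | ∃ β < α, φ = f (Par.approx f β)}

theorem Par.approx_eq {σ : Ty} (f : Par σ → Par σ) (α : Ordinal.{0}) :
    Par.approx f α = Par.sup (Par.stages f α) := by
  rw [Par.approx]
  congr 1
  ext φ
  simp [Par.stages]

theorem Par.stages_mono {σ : Ty} (f : Par σ → Par σ) : Monotone (Par.stages f) := by
  rintro α β h _ ⟨γ, hγ, rfl⟩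
  exact ⟨γ, hγ.trans_le h, rfl⟩

/-- `Par.sup` is a least upper bound only on chains, so monotonicity of the approximations below `α`
rests on the induction hypothesis. -/
theorem Par.isChain_stages {σ : Ty} {f : Par σ → Par σ} (hf : Monotone f) (α : Ordinal.{0}) :
    IsChain (· ≤ ·) (Par.stages f α) := by
  induction α using WellFoundedLT.induction with
  | ind α ih =>
    have key {β γ : Ordinal.{0}} (hβ : β < α) (hγ : γ < α) (h : β ≤ γ) :
        f (Par.approx f β) ≤ f (Par.approx f γ) := by
      refine hf ?_
      rw [Par.approx_eq f β, Par.approx_eq f γ]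
      exact (Par.isLUB_sup (ih β hβ)).mono (Par.isLUB_sup (ih γ hγ)) (Par.stages_mono f h)
    rintro _ ⟨β, hβ, rfl⟩ _ ⟨γ, hγ, rfl⟩ _
    exact (le_total β γ).imp (key hβ hγ) (key hγ hβ)

theorem Par.isLUB_approx {σ : Ty} {f : Par σ → Par σ} (hf : Monotone f) (α : Ordinal.{0}) :
    IsLUB (Par.stages f α) (Par.approx f α) := by
  rw [Par.approx_eq]
  exact Par.isLUB_sup (Par.isChain_stages hf α)

theorem Par.approx_le_lfp {σ : Ty} {f : Par σ → Par σ} (hf : Monotone f) (α : Ordinal.{0}) :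
    Par.approx f α ≤ Par.lfp f := by
  induction α using WellFoundedLT.induction with
  | ind α ih =>
    refine (Par.isLUB_approx hf α).2 ?_
    rintro _ ⟨β, hβ, rfl⟩
    exact (hf (ih β hβ)).trans (le_of_eq (Par.isLeast_lfp f hf).1)

/-- The ordinals do not inject into `Par σ`, so some approximation recurs; a recurring one is a
pre-fixed point. -/
theorem Par.exists_approx_eq_lfp {σ : Ty} {f : Par σ → Par σ} (hf : Monotone f) :
    ∃ α, Par.approx f α = Par.lfp f := by
  have h := not_injective_of_ordinal (Par.approx f)
  have key {α β : Ordinal.{0}} (h : α < β) (e : Par.approx f α = Par.approx f β) :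
      Par.approx f α = Par.lfp f := by
    refine le_antisymm (Par.approx_le_lfp hf α) (Par.lfp_le f hf ?_)
    conv_rhs => rw [e]
    exact (Par.isLUB_approx hf β).1 ⟨α, h, rfl⟩
  simp only [Function.Injective, not_forall] at h
  obtain ⟨α, β, e, hne⟩ := h
  rcases lt_or_gt_of_ne hne with h | h
  · exact ⟨α, key h e⟩
  · exact ⟨β, key h e.symm⟩

/-! ### Uniform families and their closure properties -/

/-- Pointwise comparison modulo a countably complete proper filter is well-founded. -/
theorem wellFounded_eventually_lt {I α : Type*} [Preorder α] [WellFoundedLT α] (l : Filter I)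
    [l.NeBot] [CountableInterFilter l] :
    WellFounded fun f g : I → α => ∀ᶠ i in l, f i < g i := by
  rw [wellFounded_iff_isEmpty_descending_chain]
  refine ⟨fun ⟨u, hu⟩ => ?_⟩
  -- One index satisfies all countably many inequalities, so the chain descends at that coordinate.
  obtain ⟨i, hi⟩ := (eventually_countable_forall.2 hu).exists
  exact (wellFounded_iff_isEmpty_descending_chain.1 (wellFounded_lt (α := α))).false
    ⟨fun n => u n i, hi⟩

section Uniform

variable {I : Type} (l : Filter I)

/-- A family of partial functionals is uniform with respect to a filter if it maps uniform
families of total arguments to families of values that are eventually constant as soon as they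
are eventually defined. -/
def Uniform : (σ : Ty) → (I → Par σ) → Prop
  | .nat, p => (∀ᶠ i in l, (p i : Part ℕ).Dom) → ∃ n : ℕ, ∀ᶠ i in l, (p i : Part ℕ) = Part.some n
  | .arr σ τ, φ => ∀ a : I → Tot σ, Uniform σ (fun i => Tot.toPar σ (a i)) →
      Uniform τ fun i => φ i (a i)

variable {l}

theorem Uniform.congr : ∀ {σ : Ty} {φ ψ : I → Par σ}, Uniform l σ φ → φ =ᶠ[l] ψ → Uniform l σ ψ
  | .nat, φ, ψ, h, e => by
    intro hd
    obtain ⟨n, hn⟩ := h (by filter_upwards [hd, e] with i h1 h2; rw [h2]; exact h1)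
    exact ⟨n, by filter_upwards [hn, e] with i h1 h2; rw [← h2]; exact h1⟩
  | .arr _ _, φ, ψ, h, e => fun a ha =>
    (h a ha).congr (by filter_upwards [e] with i hi; rw [hi])

theorem uniform_of_frequently_undef : ∀ {σ : Ty} {φ : I → Par σ},
    (∃ᶠ i in l, φ i = Par.undef σ) → Uniform l σ φ
  | .nat, φ, h => fun hd => by
    obtain ⟨i, h1, h2⟩ := (h.and_eventually hd).exists
    rw [h1] at h2
    exact h2.elim
  | .arr _ _, φ, h => fun a _ =>
    uniform_of_frequently_undef (h.mono fun i hi => by rw [hi]; rfl)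

/-- No chain condition is needed: a defined numerical `Par.sup` is itself a member of the set, and
higher types reduce to this pointwise. -/
theorem uniform_sup : ∀ {σ : Ty} (S : I → Set (Par σ)),
    (∀ φ : I → Par σ, (∀ᶠ i in l, φ i ∈ S i) → Uniform l σ φ) →
    Uniform l σ fun i => Par.sup (S i)
  | .nat, S, h => by
    intro hd
    have hm : ∀ᶠ i in l, (Par.sup (S i) : Par .nat) ∈ S i := by
      filter_upwards [hd] with i hi
      by_cases hn : ∃ n : ℕ, (Part.some n : Part ℕ) ∈ (S i : Set (Part ℕ))
      · have e : Par.sup (S i) = (Part.some hn.choose : Part ℕ) := dif_pos hn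
        rw [e]
        exact hn.choose_spec
      · have e : Par.sup (S i) = (Part.none : Part ℕ) := dif_neg hn
        rw [e] at hi
        exact hi.elim
    exact h _ hm hd
  | .arr σ τ, S, h => by
    intro a ha
    refine uniform_sup (fun i => (fun f : Par (.arr σ τ) => f (a i)) '' S i) fun φ hφ => ?_
    -- Membership holds only eventually; elsewhere the preimage is a dummy.
    have hc : ∀ i, ∃ f : Par (.arr σ τ),
        φ i ∈ (fun f : Par (.arr σ τ) => f (a i)) '' S i → f ∈ S i ∧ f (a i) = φ i := by
      intro i
      by_cases hi : φ i ∈ (fun f : Par (.arr σ τ) => f (a i)) '' S i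
      · obtain ⟨f, hf⟩ := hi
        exact ⟨f, fun _ => hf⟩
      · exact ⟨Par.undef _, fun h => absurd h hi⟩
    choose f hf using hc
    exact (h f (hφ.mono fun i hi => (hf i hi).1) a ha).congr (hφ.mono fun i hi => (hf i hi).2)

/-- Either the arguments are eventually total, or the application is frequently undefined and
uniformity holds vacuously. -/
theorem Uniform.app [l.NeBot] {σ τ : Ty} {u : I → Par (.arr σ τ)} {v : I → Par σ}
    (hu : Uniform l (.arr σ τ) u) (hv : Uniform l σ v) :
    Uniform l τ fun i => Par.app (u i) (v i) := by
  by_cases h : ∀ᶠ i in l, ∃ x : Tot σ, Tot.toPar σ x = v i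
  · obtain ⟨a, ha⟩ := h.choice
    refine (hu a (hv.congr (ha.mono fun i hi => hi.symm))).congr (ha.mono fun i hi => ?_)
    simp only [← hi, Par.app_toPar]
  · exact uniform_of_frequently_undef
      ((not_eventually.1 h).mono fun i hi => by unfold Par.app; exact dif_neg hi)

/-- The stage at which the fixed point is reached depends on the index, so the induction runs over
functions `I → Ordinal`, ordered by being eventually smaller. -/
theorem Uniform.lfp [l.NeBot] [CountableInterFilter l] {σ : Ty} {f : I → Par σ → Par σ}
    (hm : ∀ i, Monotone (f i))
    (hf : ∀ φ : I → Par σ, Uniform l σ φ → Uniform l σ fun i => f i (φ i)) :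
    Uniform l σ fun i => Par.lfp (f i) := by
  have key (α : I → Ordinal.{0}) : Uniform l σ fun i => Par.approx (f i) (α i) := by
    induction α using (wellFounded_eventually_lt (α := Ordinal.{0}) l).induction with
    | _ α ih =>
      simp only [Par.approx_eq]
      refine uniform_sup _ fun φ hφ => ?_
      obtain ⟨β, hβ⟩ := Eventually.choice hφ
      exact (hf _ (ih β (hβ.mono fun i hi => hi.1))).congr (hβ.mono fun i hi => hi.2.symm)
  choose α hα using fun i => Par.exists_approx_eq_lfp (hm i)
  simpa only [hα] using key α

theorem Uniform.eventually_const {a : I → ℕ}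
    (ha : Uniform l .nat fun i => Tot.toPar .nat (a i)) : ∃ n, ∀ᶠ i in l, a i = n := by
  obtain ⟨n, hn⟩ := ha (Eventually.of_forall fun i => trivial)
  exact ⟨n, hn.mono fun i hi => Part.some_injective hi⟩

theorem uniform_nat_const (p : Part ℕ) [l.NeBot] : Uniform l .nat fun _ => p := by
  intro hd
  obtain ⟨i, hi⟩ := hd.exists
  exact ⟨p.get hi, Eventually.of_forall fun _ => (Part.some_get hi).symm⟩

theorem Uniform.caseVal {z x y : I → Part ℕ} (hz : Uniform l .nat z) (hx : Uniform l .nat x)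
    (hy : Uniform l .nat y) : Uniform l .nat fun i => HigherComp.caseVal (z i) (x i) (y i) := by
  intro hd
  obtain ⟨n, hn⟩ := hz (hd.mono fun i hi => (Part.dom_iff_mem.2 (by
    obtain ⟨m, hm⟩ := Part.dom_iff_mem.1 hi
    obtain ⟨k, hk, -⟩ := Part.mem_bind_iff.1 hm
    exact ⟨k, hk⟩)))
  have e : (if n = 0 then x else y) =ᶠ[l] fun i => HigherComp.caseVal (z i) (x i) (y i) := by
    filter_upwards [hn] with i hi
    simp only [HigherComp.caseVal, hi, Part.bind_some]
    split_ifs <;> rfl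
  have h : Uniform l .nat (if n = 0 then x else y : I → Part ℕ) := by
    split_ifs
    · exact hx
    · exact hy
  exact h.congr e hd

theorem uniform_const_of_rank_le_one [l.NeBot] : ∀ {σ : Ty}, σ.rank ≤ 1 → ∀ φ : Par σ,
    Uniform l σ fun _ => φ
  | .nat, _, φ => uniform_nat_const φ
  | .arr .nat τ, h, φ => fun a ha => by
    obtain ⟨n, hn⟩ := ha.eventually_const
    exact (uniform_const_of_rank_le_one (le_of_max_le_right h) (φ n)).congr
      (hn.mono fun i hi => congrArg φ hi.symm)
  | .arr (.arr σ σ') τ, h, _ => by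
    simp only [Ty.rank] at h
    omega

/-! ### Uniformity of terms -/

/-- Families of assignments that are uniform at each variable. -/
def UniformEnv (l : Filter I) {Γ : List Ty} (ρ : I → Env Γ) : Prop :=
  ∀ {σ : Ty} (x : Var Γ σ), Uniform l σ fun i => (ρ i).get x

theorem UniformEnv.cons {Γ : List Ty} {σ : Ty} {ρ : I → Env Γ} {φ : I → Par σ}
    (hφ : Uniform l σ φ) (hρ : UniformEnv l ρ) :
    UniformEnv l (Γ := σ :: Γ) fun i => (φ i, ρ i) := by
  intro τ x
  cases x with
  | here => exact hφ
  | there x => exact hρ x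

/-- Terms have uniform interpretations at uniform assignments. -/
theorem Term.uniform_interp [l.NeBot] [CountableInterFilter l] {Γ : List Ty} {σ : Ty}
    (t : Term Γ σ) : ∀ {ρ : I → Env Γ}, UniformEnv l ρ → Uniform l σ fun i => t.interp (ρ i) := by
  induction t with
  | var _ x => exact fun h => h x
  | zero => exact fun _ => uniform_nat_const _
  | suc => exact fun _ => uniform_const_of_rank_le_one (σ := .one) le_rfl _
  | pred => exact fun _ => uniform_const_of_rank_le_one (σ := .one) le_rfl _
  | case z x y hz hx hy => exact fun h => (hz h).caseVal (hx h) (hy h)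
  | app u v hu hv => exact fun h => (hu h).app (hv h)
  | lam _ t ht => exact fun h a ha => ht (h.cons ha)
  | mu _ t ht =>
    exact fun {ρ} h => Uniform.lfp
      (fun i _ _ hψ => t.interp_mono (ρ := (_, ρ i)) (ρ' := (_, ρ i)) ⟨hψ, Env.Le.refl _⟩)
      fun φ hφ => ht (h.cons hφ)

/-! ### Uniformity of countably based functionals -/

/-- Families of argument tuples that are uniform at each position. -/
def UniformArgs (l : Filter I) : (σ : Ty) → (I → Args σ) → Prop
  | .nat, _ => True
  | .arr σ τ, a => Uniform l σ (fun i => Tot.toPar σ (a i).1) ∧ UniformArgs l τ fun i => (a i).2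

theorem uniform_toPar_iff [l.NeBot] : ∀ {σ : Ty} {φ : I → Tot σ},
    Uniform l σ (fun i => Tot.toPar σ (φ i)) ↔
      ∀ a : I → Args σ, UniformArgs l σ a → ∃ n, ∀ᶠ i in l, (φ i).eval (a i) = n
  | .nat, φ => by
    refine ⟨fun h _ _ => h.eventually_const, fun h _ => ?_⟩
    obtain ⟨n, hn⟩ := h (fun _ => ()) trivial
    exact ⟨n, hn.mono fun i hi => congrArg Part.some hi⟩
  | .arr _ _, φ =>
    ⟨fun h a ha => uniform_toPar_iff.1 (h _ ha.1) _ ha.2, fun h b hb =>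
      uniform_toPar_iff.2 fun a ha => h (fun i => (b i, a i)) ⟨hb, ha⟩⟩

theorem uniformArgs_const [l.NeBot] : ∀ {σ : Ty}, σ.rank ≤ 2 → ∀ a : Args σ,
    UniformArgs l σ fun _ => a
  | .nat, _, _ => trivial
  | .arr _ _, h, a =>
    ⟨uniform_const_of_rank_le_one (Nat.le_of_succ_le_succ (le_of_max_le_left h)) _,
      uniformArgs_const (le_of_max_le_right h) a.2⟩

theorem Tot.exists_eval_eq : ∀ {σ : Ty} (g : Args σ → ℕ), ∃ φ : Tot σ, ∀ a, φ.eval a = g a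
  | .nat, g => ⟨g (), fun _ => rfl⟩
  | .arr _ _, g => by
    choose φ hφ using fun x => Tot.exists_eval_eq fun a => g (x, a)
    exact ⟨φ, fun a => hφ a.1 a.2⟩

/-- At rank at most 2 the arguments have rank at most 1, so constant argument tuples are uniform and
the limit can be read off pointwise. -/
theorem Uniform.exists_limit [l.NeBot] {σ : Ty} (hσ : σ.rank ≤ 2) {φ : I → Tot σ}
    (hφ : Uniform l σ fun i => Tot.toPar σ (φ i)) :
    ∃ ψ : Tot σ, ∀ b, ∀ᶠ i in l, ψ.eval b = (φ i).eval b := by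
  choose g hg using fun b => uniform_toPar_iff.1 hφ _ (uniformArgs_const hσ b)
  obtain ⟨ψ, hψ⟩ := Tot.exists_eval_eq g
  exact ⟨ψ, fun b => (hg b).mono fun i hi => (hψ b).trans hi.symm⟩

theorem UniformArgs.exists_limit [l.NeBot] [CountableInterFilter l] : ∀ {σ : Ty}, σ.rank ≤ 3 →
    ∀ {a : I → Args σ}, UniformArgs l σ a →
      ∃ b : Args σ, ∀ X : Support σ, X.Countable → ∀ᶠ i in l, X.Agree b (a i)
  | .nat, _, _, _ => ⟨(), fun _ _ => Eventually.of_forall fun _ => trivial⟩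
  | .arr _ _, h, _, ha => by
    obtain ⟨ψ, hψ⟩ := ha.1.exists_limit (Nat.le_of_succ_le_succ (le_of_max_le_left h))
    obtain ⟨b, hb⟩ := UniformArgs.exists_limit (le_of_max_le_right h) ha.2
    refine ⟨(ψ, b), fun X hX => ?_⟩
    exact ((eventually_countable_ball hX.1).2 fun x _ => hψ x).and (hb X.2 hX.2)

-- The support is taken at the limit tuple `b`, so the eventual value is that of `Φ` at `b`.
theorem CountablyBased.uniform [l.NeBot] [CountableInterFilter l] {σ : Ty} (hσ : σ.rank ≤ 3)
    {Φ : Tot σ} (hΦ : CountablyBased Φ) : Uniform l σ fun _ => Tot.toPar σ Φ := by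
  refine uniform_toPar_iff.2 fun a ha => ?_
  obtain ⟨b, hb⟩ := ha.exists_limit hσ
  obtain ⟨X, hX, h⟩ := hΦ b
  exact ⟨Φ.eval b, (hb X hX).mono fun i hi => (h _ hi).symm⟩

end Uniform

/-! ### Singletons and the cocountable filter -/

open Classical in
/-- The characteristic function of `{x}`. -/
noncomputable def singletonChar (x : ℕ → ℕ) : Tot .two :=
  fun y : ℕ → ℕ => (if y = x then 1 else 0 : ℕ)

theorem isChar_singletonChar (x : ℕ → ℕ) : IsChar (singletonChar x) {x} := by
  intro y
  constructor <;> intro h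
  · exact if_pos h
  · exact if_neg h

theorem Omega1_singletonChar (x : ℕ → ℕ) (k : ℕ) :
    Omega1 (singletonChar x) k = (Part.some (x k) : Part ℕ) := by
  have h : ∃ z, IsChar (singletonChar x) {z} := ⟨x, isChar_singletonChar x⟩
  have e : h.choose = x := by
    by_contra hne
    have h1 := (h.choose_spec x).2 (Ne.symm hne)
    have h2 := (isChar_singletonChar x x).1 rfl
    omega
  refine Part.eq_some_iff.2 ⟨h, ?_⟩
  exact congrFun e k

instance : Uncountable (ℕ → ℕ) := by
  rw [← Cardinal.aleph0_lt_mk_iff]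
  simp [Cardinal.aleph0_lt_continuum]

instance {α : Type*} : CountableInterFilter (cocountable : Filter α) :=
  CardinalInterFilter.toCountableInterFilter cocountable Cardinal.aleph0_lt_aleph_one

theorem eventually_cocountable_ne {α : Type*} (a : α) : ∀ᶠ x in cocountable, x ≠ a := by
  rw [Filter.Eventually, mem_cocountable]
  exact (Set.countable_singleton a).mono fun x hx => by simpa using hx

instance {α : Type*} [Uncountable α] : (cocountable : Filter α).NeBot := by
  refine ⟨fun h => not_countable (α := α) (Set.countable_univ_iff.1 ?_)⟩
  have h1 : (∅ : Set α) ∈ (cocountable : Filter α) := h ▸ mem_bot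
  simpa using mem_cocountable.1 h1

/-- Away from its limit, a uniform family of points is not seen by the characteristic functions
of singletons. -/
theorem uniform_singletonChar :
    Uniform cocountable .two fun x : ℕ → ℕ => Tot.toPar .two (singletonChar x) := by
  intro a ha
  change (ℕ → ℕ) → ℕ → ℕ at a
  have hk (k : ℕ) : ∃ n, ∀ᶠ x in cocountable, a x k = n :=
    (ha (fun _ => k) (uniform_nat_const _)).eventually_const
  choose h hh using hk
  refine (uniform_nat_const (Part.some (0 : ℕ))).congr ?_
  -- Countable completeness joins the coordinates: eventually `a x = h`, while `x ≠ h`, so the value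
  -- is 0.
  filter_upwards [eventually_countable_forall.2 hh, eventually_cocountable_ne h] with x hx hne
  refine (congrArg (Part.some (α := ℕ)) (?_ : singletonChar x (a x) = (0 : ℕ))).symm
  exact if_neg fun e => hne (e.symm.trans (funext hx))

end HigherComp

theorem theorem31 (σ : HigherComp.Ty) (hσ : σ.rank = 3) (Φ : HigherComp.Tot σ)
    (hΦ : HigherComp.CountablyBased Φ) :
    ¬ HigherComp.ComputableIn HigherComp.Omega1 (Γ := [σ]) (HigherComp.Tot.toPar σ Φ, ()) := by
  open HigherComp Filter in
  rintro ⟨s, hs⟩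
  have hρ : UniformEnv (cocountable : Filter (ℕ → ℕ)) (Γ := [σ])
      fun _ => (Tot.toPar σ Φ, ()) := by
    intro τ x
    cases x with
    | here => exact hΦ.uniform hσ.le
    | there x => cases x
  have hval (x : ℕ → ℕ) (k : ℕ) :
      s.interp (Γ := [σ]) (Tot.toPar σ Φ, ()) (singletonChar x) k = (Part.some (x k) : Part ℕ) :=
    Part.eq_some_iff.2 (hs (singletonChar x) k (x k) (by
      rw [Omega1_singletonChar]
      exact Part.mem_some _))
  have hk (k : ℕ) : ∃ n, ∀ᶠ x in (cocountable : Filter (ℕ → ℕ)), x k = n := by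
    -- The interpretation of `s` does not vary with `x`; only its argument, the characteristic
    -- function of `{x}`, does.
    have h := s.uniform_interp hρ _ uniform_singletonChar (fun _ => k) (uniform_nat_const _)
    exact Uniform.eventually_const (h.congr (Eventually.of_forall fun x => hval x k))
  choose h hh using hk
  obtain ⟨x, hx, hne⟩ :=
    ((eventually_countable_forall.2 hh).and (eventually_cocountable_ne h)).exists
  exact hne (funext hx)
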